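/- Let $G$ be a finite group. For $n\ge 0$ let $\mathrm{Comm}_n(G)\subseteq G^n$ be the set of $n$-tuples of pairwise commuting elements (a singleton for $n=0$), on which $G$ acts by simultaneous conjugation; for $\mathbf g=(g_1,\dots,g_n)\in \mathrm{Comm}_n(G)$ let $C_G(\mathbf g)=\bigcap_i C_G(g_i)$ be the joint centralizer (equal to $G$ for $n=0$). Put $P_n(G)=|\mathrm{Comm}_n(G)|/|G|^n$ and $\kappa_n(G)=|\mathrm{Hom}(\mathbb Z^n,G)/G|$, where $G$ acts by conjugation. For a group $H$ let $k(H)$ be its number of conjugacy classes. Let $\Lambda^nG=\mathrm{Fun}(B\mathbb Z^n,BG)$ be the $n$-fold loop groupoid (the groupoid of functors between one-object groupoids, whose objects are the commuting $n$-tuples and whose morphisms are simultaneous conjugations), and $\mathbb C[\Lambda^nG]$ its groupoid algebra, with basis the morphisms and with product the composite of composable morphisms and $0$ otherwise. Let $D(G)=\mathbb C^G\rtimes\mathbb CG$ be the untwisted Drinfeld double, with basis $\delta_g\otimes x$ $(g,x\in G)$ and multiplication $(\delta_g\otimes x)(\delta_h\otimes y)=\delta_{g,xhx^{-1}}\,(\delta_g\otimes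 xy)$. For a ring $A$ let $\mathrm{Irr}(A)$ be the set of isomorphism classes of simple left $A$-modules. 1. For every integer $r\ge 2$, $$|\mathrm{Irr}(\mathbb C[\Lambda^{r-2}G])|=\sum_{[\mathbf g]\in \mathrm{Comm}_{r-2}(G)/G}k(C_G(\mathbf g))=\kappa_{r-1}(G)=|G|^{r-1}P_r(G).$$ 2. $$|\mathrm{Irr}(D(G))|=\sum_{[g]\subseteq G}k(C_G(g))=|G|^2P_3(G),$$ where the sum is over the conjugacy classes of $G$. 3. $$|\mathrm{Irr}(\mathbb C[\Lambda^2G])|=\kappa_3(G)=|G|^3P_4(G),\qquad\text{equivalently}\qquad P_4(G)=\frac{|\mathrm{Irr}(\mathbb C[\Lambda^2G])|}{|G|^3}.$$ -/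

import Mathlib

open CategoryTheory

universe u v

/-! ### Class numbers, commuting tuples, higher class numbers -/

/-- `k(H)`: the number of conjugacy classes of the group `H`. -/
noncomputable def classNumber (H : Type*) [Group H] : ℕ := Nat.card (ConjClasses H)

/-- `Comm_r(G)`: the set of `r`-tuples of pairwise commuting elements of `G`. -/
def CommTuple (r : ℕ) (G : Type*) [Group G] : Type _ :=
  {x : Fin r → G // ∀ i j, Commute (x i) (x j)}

/-- `P_r(G) = |Comm_r(G)| / |G|^r`. -/
noncomputable def higherCommProb (r : ℕ) (G : Type*) [Group G] : ℚ :=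
  (Nat.card (CommTuple r G) : ℚ) / (Nat.card G : ℚ) ^ r

/-- `G` acts on `Comm_r(G)` by simultaneous conjugation. -/
instance CommTuple.instMulAction (r : ℕ) (G : Type*) [Group G] :
    MulAction (ConjAct G) (CommTuple r G) where
  smul a x := ⟨fun i => a • x.1 i, fun i j => by
    have h : x.1 i * x.1 j = x.1 j * x.1 i := x.2 i j
    show a • x.1 i * a • x.1 j = a • x.1 j * a • x.1 i
    rw [← smul_mul', ← smul_mul', h]⟩
  one_smul x := Subtype.ext (funext fun i => one_smul _ (x.1 i))
  mul_smul a b x := Subtype.ext (funext fun i => mul_smul a b (x.1 i))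

/-- The joint centralizer `C_G(g_1, ..., g_r)` (all of `G` for the empty tuple). -/
def CommTuple.jointCentralizer {r : ℕ} {G : Type*} [Group G] (x : CommTuple r G) : Subgroup G :=
  ⨅ i, Subgroup.centralizer {x.1 i}

theorem CommTuple.mem_jointCentralizer {r : ℕ} {G : Type*} [Group G] {x : CommTuple r G} {t : G} :
    t ∈ x.jointCentralizer ↔ ∀ i, t * x.1 i = x.1 i * t := by
  simp [CommTuple.jointCentralizer, Subgroup.mem_iInf, Subgroup.mem_centralizer_singleton_iff]

theorem classNumber_congr {H K : Type*} [Group H] [Group K] (e : H ≃* K) :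
    classNumber H = classNumber K :=
  Nat.card_congr
    { toFun := ConjClasses.map e.toMonoidHom
      invFun := ConjClasses.map e.symm.toMonoidHom
      left_inv := fun c => by
        induction c using Quotient.inductionOn with
        | h a => exact congrArg ConjClasses.mk (e.symm_apply_apply a)
      right_inv := fun c => by
        induction c using Quotient.inductionOn with
        | h a => exact congrArg ConjClasses.mk (e.apply_symm_apply a) }

theorem classNumber_congr_conj {G : Type*} [Group G] {H K : Subgroup G} (a : G)
    (h : ∀ t, t ∈ H ↔ a * t * a⁻¹ ∈ K) : classNumber H = classNumber K := by
  have hK : H.map (MulAut.conj a).toMonoidHom = K := by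
    ext t
    rw [Subgroup.mem_map_equiv, h]
    simp [mul_assoc]
  exact classNumber_congr ((H.equivMapOfInjective _ (MulAut.conj a).injective).trans
    (MulEquiv.subgroupCongr hK))

/-- The function `[g] ↦ k(C_G(g))` on the set `Comm_r(G)/G` of simultaneous conjugation orbits;
the value does not depend on the representative. -/
noncomputable def centralizerClassNumber {r : ℕ} {G : Type*} [Group G] :
    MulAction.orbitRel.Quotient (ConjAct G) (CommTuple r G) → ℕ :=
  Quotient.lift (fun x => classNumber x.jointCentralizer) (by
    rintro x y ⟨a, rfl⟩
    symm
    refine classNumber_congr_conj (ConjAct.ofConjAct a) fun t => ?_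
    simp only [CommTuple.mem_jointCentralizer]
    refine forall_congr' fun i => ?_
    show t * y.1 i = y.1 i * t ↔
      ConjAct.ofConjAct a * t * (ConjAct.ofConjAct a)⁻¹ * (a • y.1 i) =
        (a • y.1 i) * (ConjAct.ofConjAct a * t * (ConjAct.ofConjAct a)⁻¹)
    rw [ConjAct.smul_def]
    simp only [mul_assoc, inv_mul_cancel_left, mul_right_inj]
    simp only [← mul_assoc, mul_left_inj])

/-- The function `[g] ↦ k(C_G(g))` on the conjugacy classes of `G`. -/
noncomputable def elementCentralizerClassNumber {G : Type*} [Group G] : ConjClasses G → ℕ :=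
  Quotient.lift (fun g : G => classNumber (Subgroup.centralizer ({g} : Set G))) (by
    intro g h hgh
    obtain ⟨a, rfl⟩ := isConj_iff.mp (show IsConj g h from hgh)
    refine classNumber_congr_conj a fun t => ?_
    simp only [Subgroup.mem_centralizer_singleton_iff]
    simp only [mul_assoc, inv_mul_cancel_left, mul_right_inj]
    simp only [← mul_assoc, mul_left_inj])

/-- The free abelian group `ℤ^r`, written multiplicatively. -/
abbrev FreeAb (r : ℕ) : Type := Multiplicative (Fin r → ℤ)

/-- `Hom(ℤ^r, G)`. -/
def FreeAbHom (r : ℕ) (G : Type*) [Group G] : Type _ := FreeAb r →* G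

/-- `G` acts on `Hom(ℤ^r, G)` by conjugation, `(a • φ)(z) = a φ(z) a⁻¹`. -/
instance FreeAbHom.instMulAction (r : ℕ) (G : Type*) [Group G] :
    MulAction (ConjAct G) (FreeAbHom r G) where
  smul a φ := ((MulAut.conj (ConjAct.ofConjAct a)).toMonoidHom.comp φ : FreeAb r →* G)
  one_smul φ := MonoidHom.ext (f := (_ : FreeAb r →* G)) fun z => by
    show (1 : G) * _ * (1 : G)⁻¹ = _
    simp
  mul_smul a b φ := MonoidHom.ext (f := (_ : FreeAb r →* G)) fun z => by
    show (ConjAct.ofConjAct (a * b)) * _ * (ConjAct.ofConjAct (a * b))⁻¹ =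
      ConjAct.ofConjAct a * (ConjAct.ofConjAct b * _ * (ConjAct.ofConjAct b)⁻¹) *
        (ConjAct.ofConjAct a)⁻¹
    simp [mul_assoc]

/-- The higher class number `κ_r(G) = |Hom(ℤ^r, G)/G|`. -/
noncomputable def higherClassNumber (r : ℕ) (G : Type*) [Group G] : ℕ :=
  Nat.card (MulAction.orbitRel.Quotient (ConjAct G) (FreeAbHom r G))

/-! ### Simple modules -/

/-- Two simple left `A`-modules are identified when they are isomorphic. -/
def simpleModuleSetoid (A : Type u) [Ring A] :
    Setoid {M : ModuleCat.{u} A // IsSimpleModule A M} where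
  r M N := Nonempty (M.1 ≃ₗ[A] N.1)
  iseqv :=
    { refl := fun _ => ⟨LinearEquiv.refl _ _⟩
      symm := fun ⟨e⟩ => ⟨e.symm⟩
      trans := fun ⟨e⟩ ⟨f⟩ => ⟨e.trans f⟩ }

/-- `Irr(A)`: the set of isomorphism classes of simple left `A`-modules. -/
def Irr (A : Type u) [Ring A] : Type (u + 1) := Quotient (simpleModuleSetoid A)

/-! ### The algebra of a finite groupoid -/

/-- The vector space `ℂ[𝒢]` with basis the morphisms of `𝒢` (which is to have finitely many
morphisms): an element is its family of coefficients. -/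
def GroupoidAlgebra (C : Type u) [Groupoid.{v} C] : Type (max u v) :=
  ∀ x y : C, (x ⟶ y) → ℂ

namespace GroupoidAlgebra

variable {C : Type u} [Groupoid.{v} C]

noncomputable instance : AddCommGroup (GroupoidAlgebra C) :=
  inferInstanceAs (AddCommGroup (∀ x y : C, (x ⟶ y) → ℂ))

noncomputable instance : Module ℂ (GroupoidAlgebra C) :=
  inferInstanceAs (Module ℂ (∀ x y : C, (x ⟶ y) → ℂ))

@[ext]
theorem ext {a b : GroupoidAlgebra C} (h : ∀ (x y : C) (f : x ⟶ y), a x y f = b x y f) : a = b :=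
  funext fun x => funext fun y => funext fun f => h x y f

open Classical in
/-- The basis element of `ℂ[𝒢]` given by a morphism `f`. -/
noncomputable def single {x y : C} (f : x ⟶ y) : GroupoidAlgebra C :=
  fun x' y' f' => if (⟨x', y', f'⟩ : Σ x y : C, x ⟶ y) = ⟨x, y, f⟩ then 1 else 0

@[simp] theorem add_apply (a b : GroupoidAlgebra C) (x y : C) (f : x ⟶ y) :
    (a + b) x y f = a x y f + b x y f := rfl

@[simp] theorem zero_apply (x y : C) (f : x ⟶ y) : (0 : GroupoidAlgebra C) x y f = 0 := rfl

@[simp] theorem smul_apply (c : ℂ) (a : GroupoidAlgebra C) (x y : C) (f : x ⟶ y) :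
    (c • a) x y f = c * a x y f := rfl

open Classical in
/-- The unit is the sum of all identity morphisms. -/
noncomputable instance : One (GroupoidAlgebra C) where
  one := fun x y f => if h : x = y then (if f = eqToHom h then 1 else 0) else 0

theorem one_apply_self {x : C} (f : x ⟶ x) [Decidable (f = 𝟙 x)] :
    (1 : GroupoidAlgebra C) x x f = if f = 𝟙 x then 1 else 0 := by
  refine (dif_pos rfl).trans ?_
  by_cases h : f = 𝟙 x <;> simp [h]

theorem one_apply_of_ne {x y : C} (f : x ⟶ y) (h : x ≠ y) :
    (1 : GroupoidAlgebra C) x y f = 0 := by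
  classical
  exact dif_neg h

theorem single_apply_self {x y : C} (f f' : x ⟶ y) [Decidable (f' = f)] :
    single f x y f' = if f' = f then 1 else 0 := by
  simp [single]

theorem single_apply_of_ne {x y x' y' : C} (f : x ⟶ y) (f' : x' ⟶ y') (h : ¬(x' = x ∧ y' = y)) :
    single f x' y' f' = 0 := by
  refine if_neg fun e => h ?_
  cases e
  exact ⟨rfl, rfl⟩

variable [Finite C] [∀ x y : C, Finite (x ⟶ y)]

attribute [local instance] Fintype.ofFinite

/-- The bilinear product with `g * f = g ∘ f` for composable morphisms and `0` otherwise, in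
coefficients: the coefficient of `a * b` at `h` is `∑ a(g) b(f)` over all factorizations
`h = g ∘ f`, and here `g = h ∘ f⁻¹`. -/
noncomputable instance : Mul (GroupoidAlgebra C) where
  mul a b := fun x y h => ∑ z : C, ∑ f : x ⟶ z, a z y (Groupoid.inv f ≫ h) * b x z f

theorem mul_apply (a b : GroupoidAlgebra C) {x y : C} (h : x ⟶ y) :
    (a * b) x y h = ∑ z : C, ∑ f : x ⟶ z, a z y (Groupoid.inv f ≫ h) * b x z f := rfl

theorem one_mul' (a : GroupoidAlgebra C) : 1 * a = a := by
  classical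
  ext x y h
  rw [mul_apply, Finset.sum_eq_single y]
  · rw [Finset.sum_eq_single h]
    · rw [one_apply_self]
      simp
    · intro f _ hf
      rw [one_apply_self, if_neg, zero_mul]
      intro e
      apply hf
      have := congrArg (fun t => f ≫ t) e
      simpa using this.symm
    · simp
  · intro z _ hz
    exact Finset.sum_eq_zero fun f _ => by rw [one_apply_of_ne _ hz, zero_mul]
  · simp

theorem mul_one' (a : GroupoidAlgebra C) : a * 1 = a := by
  classical
  ext x y h
  rw [mul_apply, Finset.sum_eq_single x]
  · rw [Finset.sum_eq_single (𝟙 x)]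
    · rw [one_apply_self]
      simp
    · intro f _ hf
      rw [one_apply_self, if_neg hf, mul_zero]
    · simp
  · intro z _ hz
    exact Finset.sum_eq_zero fun f _ => by rw [one_apply_of_ne _ hz.symm, mul_zero]
  · simp

theorem mul_assoc' (a b c : GroupoidAlgebra C) : a * b * c = a * (b * c) := by
  ext x y h
  simp only [mul_apply, Finset.sum_mul, Finset.mul_sum]
  calc ∑ z : C, ∑ f : x ⟶ z, ∑ w : C, ∑ g : z ⟶ w,
        a w y (Groupoid.inv g ≫ Groupoid.inv f ≫ h) * b z w g * c x z f
      = ∑ z : C, ∑ f : x ⟶ z, ∑ w : C, ∑ k : x ⟶ w,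
        a w y (Groupoid.inv k ≫ h) * (b z w (Groupoid.inv f ≫ k) * c x z f) := by
        refine Finset.sum_congr rfl fun z _ => Finset.sum_congr rfl fun f _ =>
          Finset.sum_congr rfl fun w _ => ?_
        refine Fintype.sum_equiv
          { toFun := fun g => f ≫ g
            invFun := fun k => Groupoid.inv f ≫ k
            left_inv := fun g => by simp
            right_inv := fun k => by simp } _ _ fun g => ?_
        simp [mul_assoc]
    _ = ∑ z : C, ∑ w : C, ∑ f : x ⟶ z, ∑ k : x ⟶ w,
        a w y (Groupoid.inv k ≫ h) * (b z w (Groupoid.inv f ≫ k) * c x z f) :=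
        Finset.sum_congr rfl fun z _ => Finset.sum_comm
    _ = ∑ w : C, ∑ z : C, ∑ k : x ⟶ w, ∑ f : x ⟶ z,
        a w y (Groupoid.inv k ≫ h) * (b z w (Groupoid.inv f ≫ k) * c x z f) := by
        rw [Finset.sum_comm]
        exact Finset.sum_congr rfl fun z _ => Finset.sum_congr rfl fun w _ => Finset.sum_comm
    _ = _ := Finset.sum_congr rfl fun w _ => Finset.sum_comm

noncomputable instance : Ring (GroupoidAlgebra C) :=
  { (inferInstance : AddCommGroup (GroupoidAlgebra C)),
    (inferInstance : Mul (GroupoidAlgebra C)),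
    (inferInstance : One (GroupoidAlgebra C)) with
    left_distrib := fun a b c => by
      ext x y h
      simp [mul_apply, mul_add, Finset.sum_add_distrib]
    right_distrib := fun a b c => by
      ext x y h
      simp [mul_apply, add_mul, Finset.sum_add_distrib]
    zero_mul := fun a => by
      ext x y h
      simp [mul_apply]
    mul_zero := fun a => by
      ext x y h
      simp [mul_apply]
    mul_assoc := mul_assoc'
    one_mul := one_mul'
    mul_one := mul_one' }

noncomputable instance : Algebra ℂ (GroupoidAlgebra C) :=
  Algebra.ofModule
    (fun r a b => by
      ext x y h
      simp [mul_apply, Finset.mul_sum, mul_assoc])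
    (fun r a b => by
      ext x y h
      simp [mul_apply, Finset.mul_sum, mul_left_comm])

theorem single_mul_single {x y z : C} (g : y ⟶ z) (f : x ⟶ y) :
    single g * single f = single (f ≫ g) := by
  classical
  ext x' z' h
  rw [mul_apply]
  by_cases hxz : x' = x ∧ z' = z
  · obtain ⟨rfl, rfl⟩ := hxz
    rw [Finset.sum_eq_single y, Finset.sum_eq_single f]
    · rw [single_apply_self, single_apply_self, single_apply_self, if_pos rfl, mul_one]
      refine if_congr ⟨fun e => ?_, fun e => ?_⟩ rfl rfl
      · rw [← e]
        simp
      · rw [e]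
        simp
    · intro f' _ hf
      rw [single_apply_self f, if_neg hf, mul_zero]
    · simp
    · intro w _ hw
      exact Finset.sum_eq_zero fun k _ => by
        rw [single_apply_of_ne f k (fun e => hw e.2), mul_zero]
    · simp
  · rw [single_apply_of_ne _ _ hxz]
    refine Finset.sum_eq_zero fun w _ => Finset.sum_eq_zero fun k _ => ?_
    by_cases hx : x' = x
    · rw [single_apply_of_ne g _ (fun e => hxz ⟨hx, e.2⟩), zero_mul]
    · rw [single_apply_of_ne f k (fun e => hx e.1), mul_zero]

theorem single_mul_single_of_ne {x y y' z : C} (g : y' ⟶ z) (f : x ⟶ y) (hy : y' ≠ y) :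
    single g * single f = 0 := by
  ext x' z' h
  rw [mul_apply]
  refine Finset.sum_eq_zero fun w _ => Finset.sum_eq_zero fun k _ => ?_
  by_cases hw : w = y
  · rw [single_apply_of_ne g _ (fun e => hy (e.1.symm.trans hw)), zero_mul]
  · rw [single_apply_of_ne f k (fun e => hw e.2), mul_zero]

end GroupoidAlgebra

/-! ### Iterated loop groupoids -/

/-- The `n`-fold loop groupoid `Λⁿ G = Fun(Bℤⁿ, BG)`: functors between one-object groupoids, with
natural transformations as morphisms. -/
def LoopGroupoid (n : ℕ) (G : Type u) [Group G] : Type u :=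
  SingleObj (FreeAb n) ⥤ SingleObj G

namespace LoopGroupoid

variable (n : ℕ) (G : Type u) [Group G]

instance : Groupoid.{u} (LoopGroupoid n G) :=
  { (inferInstanceAs (Category (SingleObj (FreeAb n) ⥤ SingleObj G)) :
      Category.{u} (LoopGroupoid n G)) with
    inv := fun {F F'} α =>
      ({ app := fun x => Groupoid.inv (NatTrans.app (F := F) (G := F') α x)
         naturality := fun x y z => by
          have h := NatTrans.naturality (F := F) (G := F') α z
          rw [Groupoid.inv_eq_inv, Groupoid.inv_eq_inv, IsIso.eq_inv_comp, ← Category.assoc,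
            ← h, Category.assoc, IsIso.hom_inv_id, Category.comp_id] } : NatTrans F' F)
    inv_comp := fun {F F'} α => NatTrans.ext (funext fun x => Groupoid.inv_comp _)
    comp_inv := fun {F F'} α => NatTrans.ext (funext fun x => Groupoid.comp_inv _) }

instance [Finite G] : Finite (LoopGroupoid n G) := by
  have h : Function.Injective
      (fun (φ : FreeAb n →* G) (i : Fin n) => φ (Multiplicative.ofAdd (Pi.single i 1))) := by
    intro φ ψ hφ
    have : (MonoidHom.toAdditiveRight φ : (Fin n → ℤ) →+ Additive G) =
        MonoidHom.toAdditiveRight ψ := by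
      refine AddMonoidHom.pi_ext fun i k => ?_
      have hk : Pi.single (M := fun _ : Fin n => ℤ) i k = k • Pi.single i 1 := by
        rw [← Pi.single_smul]
        simp
      rw [hk, map_zsmul, map_zsmul]
      exact congrArg (fun t : Additive G => k • t) (congrFun hφ i)
    exact MonoidHom.toAdditiveRight.injective this
  have : Finite (FreeAb n →* G) := Finite.of_injective _ h
  exact Finite.of_equiv _ (SingleObj.mapHom (FreeAb n) G)

instance [Finite G] (F F' : LoopGroupoid n G) : Finite (F ⟶ F') :=
  Finite.of_injective (β := G)
    (fun α => NatTrans.app (F := F) (G := F') α (SingleObj.star (FreeAb n)))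
    (fun _ _ h => NatTrans.ext (funext fun _ => h))

end LoopGroupoid

/-! ### The Drinfeld double -/

/-- The algebra `ℂ^G` of functions `G → ℂ` with pointwise operations. -/
def FunctionAlgebra (G : Type u) : Type u := G → ℂ

namespace FunctionAlgebra

variable {G : Type u}

noncomputable instance : CommRing (FunctionAlgebra G) := inferInstanceAs (CommRing (G → ℂ))

noncomputable instance : Algebra ℂ (FunctionAlgebra G) := inferInstanceAs (Algebra ℂ (G → ℂ))

/-- `G` acts on `ℂ^G` by conjugation, `(x • a)(g) = a(x⁻¹ g x)`. -/
instance [Group G] : MulSemiringAction G (FunctionAlgebra G) where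
  smul x a := fun g => a (x⁻¹ * g * x)
  one_smul a := funext fun g => congrArg a (by simp)
  mul_smul x y a := funext fun g => congrArg a (by simp [mul_assoc])
  smul_zero _ := rfl
  smul_add _ _ _ := rfl
  smul_one _ := rfl
  smul_mul _ _ _ := rfl

instance [Group G] : SMulCommClass G ℂ (FunctionAlgebra G) where
  smul_comm _ _ _ := rfl

open Classical in
/-- The indicator function of `g`. -/
noncomputable def delta (g : G) : FunctionAlgebra G := fun g' => if g' = g then 1 else 0

theorem smul_delta [Group G] (x h : G) : x • delta h = delta (x * h * x⁻¹) := by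
  classical
  refine funext fun g => ?_
  show (if x⁻¹ * g * x = h then (1 : ℂ) else 0) = if g = x * h * x⁻¹ then 1 else 0
  refine if_congr ⟨fun e => ?_, fun e => ?_⟩ rfl rfl
  · rw [← e]
    group
  · rw [e]
    group

open Classical in
theorem delta_mul_delta (g h : G) : delta g * delta h = if g = h then delta g else 0 := by
  refine funext fun k => ?_
  show (if k = g then (1 : ℂ) else 0) * (if k = h then 1 else 0) = _
  by_cases hgh : g = h
  · subst hgh
    simp [delta]
  · rw [if_neg hgh]
    show _ = (0 : ℂ)
    by_cases hk : k = g
    · subst hk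
      simp [hgh]
    · simp [hk]

end FunctionAlgebra

/-- The Drinfeld double `D(G)` as an algebra: the crossed product `ℂ^G ⋊ ℂG`, with basis the
elements `δ_g ⊗ x = SkewMonoidAlgebra.single x (delta g)` for `g, x ∈ G`. -/
abbrev DrinfeldDouble (G : Type u) [Group G] : Type u := SkewMonoidAlgebra (FunctionAlgebra G) G

open Classical in
/-- `(δ_g ⊗ x)(δ_h ⊗ y) = δ_{g, x h x⁻¹} (δ_g ⊗ x y)`. -/
theorem DrinfeldDouble.basis_mul_basis {G : Type u} [Group G] (g h x y : G) :
    (SkewMonoidAlgebra.single x (FunctionAlgebra.delta g) *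
      SkewMonoidAlgebra.single y (FunctionAlgebra.delta h) : DrinfeldDouble G) =
    if g = x * h * x⁻¹ then SkewMonoidAlgebra.single (x * y) (FunctionAlgebra.delta g) else 0 := by
  rw [SkewMonoidAlgebra.single_mul_single, FunctionAlgebra.smul_delta,
    FunctionAlgebra.delta_mul_delta]
  split_ifs <;> simp

/-!
The simple modules of a finite-dimensional semisimple algebra `A` over an algebraically closed field
are counted by the dimension of its centre (`Irr.card_eq_finrank_center`): they correspond to the
isotypic components of the regular module, and `Aᵐᵒᵖ ≃ End_A(A)` is the product of the
endomorphism rings of these components, each of which is a matrix algebra over the field by Schur's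
lemma and so contributes one dimension to the centre.

The algebra of a finite groupoid is semisimple by the averaging argument of Maschke, and its central
elements are exactly the conjugation-invariant functions supported on automorphisms. Hence its
simple modules are counted by the conjugacy classes of automorphisms (`GroupoidAlgebra.card_irr`).
An automorphism in `Λⁿ G` is a commuting `(n+1)`-tuple, with conjugacy being simultaneous
conjugation (`LoopGroupoid.autEquiv`), so `|Irr ℂ[Λⁿ G]|` is the number of `G`-orbits on
`Comm_{n+1}(G)`, which is `κ_{n+1}(G)`.

What is left is counting. A commuting `(n+1)`-tuple is a commuting `n`-tuple together with an
element of its joint centralizer, that is, of its stabilizer; Burnside's lemma gives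
`|Comm_{n+1}(G)| = |G| · |Comm_n(G)/G|`. Adding a commuting pair of elements of the joint
centralizer `C(x)` instead, of which there are `|C(x)| · k(C(x))`, the same orbit count weighted by
`k(C(x))` gives `|Comm_{n+2}(G)| = |G| · ∑ k(C(x))`, the sum over `Comm_n(G)/G`. Comparing the two
yields `CommTuple.finsum_centralizerClassNumber`.

The Drinfeld double reduces to the groupoid case, since `D(G) ≃ ℂ[ΛG]` sends the basis element
`δ_g ⊗ x` to the morphism `x⁻¹ g x ⟶ g` given by `x` (`DrinfeldDouble.loopAlgEquiv`).
-/

/-! ### Simple modules of a semisimple algebra -/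

namespace Irr

/-- The class in `Irr(A)` of a simple module. -/
def mk {A : Type u} [Ring A] (M : Type u) [AddCommGroup M] [Module A M]
    [h : IsSimpleModule A M] : Irr A :=
  Quotient.mk (simpleModuleSetoid A) ⟨ModuleCat.of A M, h⟩

theorem mk_eq_mk {A : Type u} [Ring A] {M N : Type u} [AddCommGroup M] [Module A M]
    [IsSimpleModule A M] [AddCommGroup N] [Module A N] [IsSimpleModule A N] :
    mk (A := A) M = mk N ↔ Nonempty (M ≃ₗ[A] N) :=
  Quotient.eq (r := simpleModuleSetoid A)

/-- Every simple module over a semisimple ring embeds into the regular module, and it is determined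
up to isomorphism by the isotypic component it generates there. -/
theorem card_eq_card_isotypicComponents (A : Type u) [Ring A] [IsSemisimpleRing A] :
    Nat.card (Irr A) = Nat.card (isotypicComponents A A) := by
  classical
  choose S hS hS' using fun c : isotypicComponents A A => c.2
  symm
  refine Nat.card_congr (Equiv.ofBijective (fun c => haveI := hS c; mk (S c)) ⟨?_, ?_⟩)
  · intro c d h
    have := hS c
    have := hS d
    obtain ⟨e⟩ := mk_eq_mk.1 h
    exact Subtype.ext ((hS' c).trans (e.isotypicComponent_eq.trans (hS' d).symm))
  · intro q
    induction q using Quotient.inductionOn with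
    | h M =>
      obtain ⟨M, hM⟩ := M
      obtain ⟨I, ⟨e⟩⟩ := IsSemisimpleRing.exists_linearEquiv_ideal_of_isSimpleModule A M
      have hI : IsSimpleModule A I := IsSimpleModule.congr e.symm
      refine ⟨⟨isotypicComponent A A I, I, hI, rfl⟩, ?_⟩
      set c : isotypicComponents A A := ⟨isotypicComponent A A I, I, hI, rfl⟩
      have := hS c
      refine mk_eq_mk.2 ?_
      have hle : I ≤ isotypicComponent A A (S c) := by
        rw [← hS' c]; exact Submodule.le_isotypicComponent I
      obtain ⟨e'⟩ := isIsotypicOfType_submodule_iff.1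
        (IsIsotypicOfType.isotypicComponent A A (S c)) I hle
      exact ⟨e'.symm.trans e.symm⟩

end Irr

section Center

variable (F : Type v) [Field F]

theorem finrank_center_congr {A : Type*} {B : Type*} [Ring A] [Ring B] [Algebra F A] [Algebra F B]
    (e : A ≃ₐ[F] B) :
    Module.finrank F (Subalgebra.center F A) = Module.finrank F (Subalgebra.center F B) := by
  refine LinearEquiv.finrank_eq (LinearEquiv.ofSubmodules e.toLinearEquiv
    (Subalgebra.toSubmodule (Subalgebra.center F A))
    (Subalgebra.toSubmodule (Subalgebra.center F B)) ?_)
  ext b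
  simp only [Submodule.mem_map, Subalgebra.mem_toSubmodule, Subalgebra.mem_center_iff]
  constructor
  · rintro ⟨a, ha, rfl⟩ b
    obtain ⟨b, rfl⟩ := e.surjective b
    simpa using congrArg e (ha b)
  · intro h
    refine ⟨e.symm b, fun a => ?_, by simp⟩
    simpa using congrArg e.symm (h (e a))

theorem finrank_center_op {A : Type*} [Ring A] [Algebra F A] :
    Module.finrank F (Subalgebra.center F Aᵐᵒᵖ) = Module.finrank F (Subalgebra.center F A) := by
  symm
  refine LinearEquiv.finrank_eq (LinearEquiv.ofSubmodules (MulOpposite.opLinearEquiv F)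
    (Subalgebra.toSubmodule (Subalgebra.center F A))
    (Subalgebra.toSubmodule (Subalgebra.center F Aᵐᵒᵖ)) ?_)
  ext b
  induction b using MulOpposite.rec' with | h b => ?_
  simp only [Submodule.mem_map, Subalgebra.mem_toSubmodule, Subalgebra.mem_center_iff]
  constructor
  · rintro ⟨a, ha, h⟩ c
    obtain rfl : a = b := by simpa using h
    exact congrArg MulOpposite.op (ha c.unop).symm
  · intro h
    exact ⟨b, fun a => (congrArg MulOpposite.unop (h (MulOpposite.op a))).symm, rfl⟩

theorem finrank_center_pi_of_isCentral {ι : Type*} [Finite ι] (B : ι → Type*)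
    [∀ i, Ring (B i)] [∀ i, Algebra F (B i)] [∀ i, Nontrivial (B i)]
    [∀ i, Algebra.IsCentral F (B i)] :
    Module.finrank F (Subalgebra.center F (Π i, B i)) = Nat.card ι := by
  have := Fintype.ofFinite ι
  rw [Nat.card_eq_fintype_card, ← Module.finrank_fintype_fun_eq_card F]
  symm
  let f : (ι → F) →ₗ[F] (Π i, B i) :=
    LinearMap.pi fun i => (Algebra.linearMap F (B i)).comp (LinearMap.proj i)
  have hf : Function.Injective f := fun x y h => funext fun i =>
    FaithfulSMul.algebraMap_injective F (B i) (congrFun h i)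
  have hr : LinearMap.range f = Subalgebra.toSubmodule (Subalgebra.center F (Π i, B i)) := by
    ext b
    rw [Subalgebra.mem_toSubmodule, Subalgebra.center_pi, LinearMap.mem_range]
    constructor
    · rintro ⟨x, rfl⟩ i -
      exact Subalgebra.algebraMap_mem _ _
    · intro h
      choose x hx using fun i => (Algebra.IsCentral.mem_center_iff F).1 (h i trivial)
      exact ⟨x, funext fun i => (hx i).symm⟩
  exact ((LinearEquiv.ofInjective f hf).trans (LinearEquiv.ofEq _ _ hr)).finrank_eq

variable [IsAlgClosed F] (A : Type u) [Ring A] [Algebra F A] [FiniteDimensional F A]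

/-- An isotypic component of the regular module is `Sⁿ` for a simple module `S`, so its endomorphism
ring is a matrix ring over the scalars. -/
theorem isCentral_end_isotypicComponents [IsSemisimpleRing A] (c : isotypicComponents A A) :
    Algebra.IsCentral F (Module.End A c.1) := by
  have := IsArtinianRing.of_finite F A
  have hc : IsIsotypic A c.1 := IsIsotypic.isotypicComponents c.2
  obtain ⟨n, hn, S, hS, ⟨e⟩⟩ := hc.linearEquiv_fun
  have hfin : FiniteDimensional F S := FiniteDimensional.of_injective
    ((c.1.subtype.comp S.subtype).restrictScalars F)
      (c.1.subtype_injective.comp S.subtype_injective)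
  -- by Schur's lemma every endomorphism of `S` is a scalar
  have hS : Algebra.IsCentral F (Module.End A S) := ⟨fun f _ =>
    Algebra.mem_bot.2 ((IsSimpleModule.algebraMap_end_bijective_of_isAlgClosed F).2 f)⟩
  have e2 : Module.End A c.1 ≃ₐ[F] Matrix (Fin n) (Fin n) (Module.End A S) :=
    (e.conjAlgEquiv F).trans (endVecAlgEquivMatrixEnd (Fin n) F A S)
  exact Algebra.IsCentral.of_algEquiv F _ _ e2.symm

/-- The number of simple modules of a finite-dimensional semisimple algebra over an algebraically
closed field is the dimension of the centre. -/
theorem Irr.card_eq_finrank_center [IsSemisimpleRing A] :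
    Nat.card (Irr A) = Module.finrank F (Subalgebra.center F A) := by
  classical
  have := IsArtinianRing.of_finite F A
  have := isCentral_end_isotypicComponents F A
  rw [card_eq_card_isotypicComponents, ← finrank_center_op,
    finrank_center_congr F (AlgEquiv.moduleEndSelf F),
    finrank_center_congr F (IsSemisimpleModule.endAlgEquiv F A A),
    finrank_center_pi_of_isCentral]

end Center

/-! ### The algebra of a finite groupoid -/

namespace GroupoidAlgebra

section Basis

variable (C : Type u) [Groupoid.{v} C]

/-- Coefficients as a family indexed by the set of all morphisms. -/
noncomputable def coeffEquiv : GroupoidAlgebra C ≃ₗ[ℂ] ((Σ x y : C, x ⟶ y) → ℂ) where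
  toFun a m := a m.1 m.2.1 m.2.2
  invFun b := fun x y f => b ⟨x, y, f⟩
  map_add' _ _ := rfl
  map_smul' _ _ := rfl
  left_inv _ := rfl
  right_inv _ := rfl

variable [Finite C] [∀ x y : C, Finite (x ⟶ y)]

/-- The basis of `ℂ[𝒢]` given by the morphisms of `𝒢`. -/
noncomputable def basis : Module.Basis (Σ x y : C, x ⟶ y) ℂ (GroupoidAlgebra C) :=
  Module.Basis.ofEquivFun (coeffEquiv C)

variable {C}

theorem basis_apply {x y : C} (f : x ⟶ y) : basis C ⟨x, y, f⟩ = single f := by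
  classical
  refine (Module.Basis.coe_ofEquivFun (coeffEquiv C) ▸ rfl :
    basis C ⟨x, y, f⟩ = (coeffEquiv C).symm (Pi.single ⟨x, y, f⟩ 1)).trans ?_
  ext x' y' f'
  exact Pi.single_apply ..

instance : FiniteDimensional ℂ (GroupoidAlgebra C) := Module.Finite.of_basis (basis C)

end Basis

variable {C : Type u} [Groupoid.{v} C] [Finite C] [∀ x y : C, Finite (x ⟶ y)]

attribute [local instance] Fintype.ofFinite

theorem single_mul_apply {u v x : C} (h : u ⟶ v) (a : GroupoidAlgebra C) (k : x ⟶ v) :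
    (single h * a) x v k = a x u (k ≫ Groupoid.inv h) := by
  classical
  rw [mul_apply, Finset.sum_eq_single u, Finset.sum_eq_single (k ≫ Groupoid.inv h)]
  · rw [single_apply_self, if_pos (by simp), one_mul]
  · intro f _ hf
    rw [single_apply_self, if_neg, zero_mul]
    rintro rfl
    exact hf (by simp)
  · simp
  · intro z _ hz
    exact Finset.sum_eq_zero fun f _ => by
      rw [single_apply_of_ne _ _ (fun e => hz e.1), zero_mul]
  · simp

theorem single_mul_apply_of_ne {u v x y : C} (h : u ⟶ v) (a : GroupoidAlgebra C) (k : x ⟶ y)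
    (hy : y ≠ v) : (single h * a) x y k = 0 := by
  rw [mul_apply]
  exact Finset.sum_eq_zero fun z _ => Finset.sum_eq_zero fun f _ => by
    rw [single_apply_of_ne _ _ (fun e => hy e.2), zero_mul]

theorem mul_single_apply {u v y : C} (h : u ⟶ v) (a : GroupoidAlgebra C) (k : u ⟶ y) :
    (a * single h) u y k = a v y (Groupoid.inv h ≫ k) := by
  classical
  rw [mul_apply, Finset.sum_eq_single v, Finset.sum_eq_single h]
  · rw [single_apply_self, if_pos rfl, mul_one]
  · intro f _ hf
    rw [single_apply_self, if_neg hf, mul_zero]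
  · simp
  · intro z _ hz
    exact Finset.sum_eq_zero fun f _ => by
      rw [single_apply_of_ne _ _ (fun e => hz e.2), mul_zero]
  · simp

theorem mul_single_apply_of_ne {u v x y : C} (h : u ⟶ v) (a : GroupoidAlgebra C) (k : x ⟶ y)
    (hx : x ≠ u) : (a * single h) x y k = 0 := by
  rw [mul_apply]
  exact Finset.sum_eq_zero fun z _ => Finset.sum_eq_zero fun f _ => by
    rw [single_apply_of_ne _ _ (fun e => hx e.1), mul_zero]

/-! ### Maschke's theorem for finite groupoids -/

theorem sum_single_id : ∑ x : C, single (𝟙 x) = (1 : GroupoidAlgebra C) := by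
  classical
  have h (a : GroupoidAlgebra C) : (∑ x : C, single (𝟙 x)) * a = a := by
    refine LinearMap.congr_fun ((basis C).ext
      (f₁ := LinearMap.mulLeft ℂ (∑ x : C, single (𝟙 x))) (f₂ := LinearMap.id) ?_) a
    rintro ⟨x, y, f⟩
    rw [basis_apply, LinearMap.mulLeft_apply, LinearMap.id_apply, Finset.sum_mul,
      Finset.sum_eq_single y]
    · rw [single_mul_single, Category.comp_id]
    · intro z _ hz
      exact single_mul_single_of_ne _ _ hz
    · simp
  rw [← h 1, mul_one]

/-- The number of morphisms out of an object, with arbitrary target. -/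
noncomputable def outDegree (x : C) : ℕ := Nat.card (Σ y : C, x ⟶ y)

omit [Finite C] [∀ x y : C, Finite (x ⟶ y)] in
theorem outDegree_eq {a b : C} (h : a ⟶ b) : outDegree a = outDegree b :=
  Nat.card_congr (Equiv.sigmaCongrRight fun y =>
    { toFun := fun f => Groupoid.inv h ≫ f
      invFun := fun f => h ≫ f
      left_inv := fun f => by simp
      right_inv := fun f => by simp })

theorem outDegree_ne_zero (x : C) : outDegree x ≠ 0 :=
  have : Nonempty (Σ y : C, x ⟶ y) := ⟨⟨x, 𝟙 x⟩⟩
  Nat.card_pos.ne'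

variable {M : Type*} [AddCommGroup M] [Module ℂ M] [Module (GroupoidAlgebra C) M]
  [IsScalarTower ℂ (GroupoidAlgebra C) M]

/-- The average `∑_f |out(x)|⁻¹ f⁻¹ ∘ π ∘ f`, over all morphisms `f : x ⟶ y`, of a `ℂ`-linear map
`π` from the regular `ℂ[𝒢]`-module to a `ℂ[𝒢]`-module. -/
noncomputable def average (π : GroupoidAlgebra C →ₗ[ℂ] M) : GroupoidAlgebra C →ₗ[ℂ] M :=
  ∑ x : C, ∑ y : C, ∑ f : x ⟶ y, (outDegree x : ℂ)⁻¹ •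
    (Module.toModuleEnd ℂ (S := GroupoidAlgebra C) M (single (Groupoid.inv f))) ∘ₗ π ∘ₗ
      LinearMap.mulLeft ℂ (single f)

theorem average_apply (π : GroupoidAlgebra C →ₗ[ℂ] M) (a : GroupoidAlgebra C) :
    average π a = ∑ x : C, ∑ y : C, ∑ f : x ⟶ y, (outDegree x : ℂ)⁻¹ •
      (single (Groupoid.inv f) : GroupoidAlgebra C) • π (single f * a) := by
  simp [average, LinearMap.sum_apply]

/-- The average is `ℂ[𝒢]`-linear: substituting `h ≫ f` for `f` moves `h` across, and the
normalization does not change because `h` identifies the morphisms out of its two ends. -/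
theorem average_single_mul (π : GroupoidAlgebra C →ₗ[ℂ] M) {u v : C} (h : u ⟶ v)
    (a : GroupoidAlgebra C) : average π (single h * a) = single h • average π a := by
  rw [average_apply, average_apply, Finset.sum_eq_single v]
  rotate_left
  · intro x _ hx
    refine Finset.sum_eq_zero fun y _ => Finset.sum_eq_zero fun f _ => ?_
    rw [← mul_assoc, single_mul_single_of_ne f h hx, zero_mul, map_zero, smul_zero, smul_zero]
  · simp
  rw [Finset.smul_sum]
  refine Eq.trans ?_ (Finset.sum_eq_single u ?_ ?_).symm
  rotate_left
  · intro x _ hx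
    simp only [Finset.smul_sum]
    refine Finset.sum_eq_zero fun y _ => Finset.sum_eq_zero fun f _ => ?_
    rw [smul_comm, smul_smul (single h), single_mul_single_of_ne h _ hx.symm, zero_smul, smul_zero]
  · simp
  simp only [Finset.smul_sum]
  refine Finset.sum_congr rfl fun y _ => ?_
  refine Fintype.sum_equiv
    { toFun := fun f => h ≫ f
      invFun := fun f => Groupoid.inv h ≫ f
      left_inv := fun f => by simp
      right_inv := fun f => by simp } _ _ fun f => ?_
  rw [smul_comm (single h), smul_smul (single h), single_mul_single, ← mul_assoc,
    single_mul_single, outDegree_eq h]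
  simp

/-- A `ℂ`-linear projection onto a left ideal averages to a `ℂ[𝒢]`-linear one. -/
instance : IsSemisimpleRing (GroupoidAlgebra C) := by
  refine { exists_isCompl := fun p => ?_ }
  obtain ⟨π, hπ⟩ := (p.restrictScalars ℂ).subtype.exists_leftInverse_of_injective
    (Submodule.ker_subtype _)
  replace hπ (a : GroupoidAlgebra C) (ha : a ∈ p) : π a = (⟨a, ha⟩ : p) :=
    LinearMap.congr_fun hπ ⟨a, ha⟩
  let π' : GroupoidAlgebra C →ₗ[ℂ] p := π
  have hlin (b a : GroupoidAlgebra C) : average π' (b * a) = b • average π' a := by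
    refine LinearMap.congr_fun ((basis C).ext
      (f₁ := (average π').comp (LinearMap.mulRight ℂ a))
      (f₂ := (LinearMap.toSpanSingleton (GroupoidAlgebra C) p (average π' a)).restrictScalars ℂ) ?_) b
    rintro ⟨x, y, f⟩
    rw [basis_apply]
    exact average_single_mul π' f a
  let Φ : GroupoidAlgebra C →ₗ[GroupoidAlgebra C] p :=
    { toFun := average π'
      map_add' := map_add _
      map_smul' := hlin }
  refine ⟨LinearMap.ker Φ, LinearMap.isCompl_of_proj fun a => ?_⟩
  change average π' a = a
  rw [average_apply]
  -- since `π` fixes the ideal, the term of `f : x ⟶ y` is `|out(x)|⁻¹ 𝟙_x a`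
  have key (x y : C) (f : x ⟶ y) : (outDegree x : ℂ)⁻¹ •
      (single (Groupoid.inv f) : GroupoidAlgebra C) • π' (single f * (a : GroupoidAlgebra C)) =
      (outDegree x : ℂ)⁻¹ • (single (𝟙 x) : GroupoidAlgebra C) • a := by
    rw [show π' (single f * (a : GroupoidAlgebra C)) = (single f : GroupoidAlgebra C) • a from
      hπ _ (p.smul_mem _ a.2), smul_smul (single _), single_mul_single, Groupoid.comp_inv]
  simp only [key]
  have key2 (x : C) : ∑ y : C, ∑ f : x ⟶ y,
      (outDegree x : ℂ)⁻¹ • (single (𝟙 x) : GroupoidAlgebra C) • a =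
      (single (𝟙 x) : GroupoidAlgebra C) • a := by
    rw [← Fintype.sum_sigma' (fun (y : C) (f : x ⟶ y) =>
      (outDegree x : ℂ)⁻¹ • (single (𝟙 x) : GroupoidAlgebra C) • a), Finset.sum_const,
      Finset.card_univ, Fintype.card_eq_nat_card, ← Nat.cast_smul_eq_nsmul ℂ, smul_smul,
      ← outDegree, mul_inv_cancel₀ (Nat.cast_ne_zero.2 (outDegree_ne_zero x)), one_smul]
  simp only [key2]
  rw [← Finset.sum_smul, sum_single_id, one_smul]

/-! ### The centre of a groupoid algebra -/

/-- Conjugacy of automorphisms, possibly of different objects, by a morphism between the objects. -/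
def autSetoid (C : Type u) [Groupoid.{v} C] : Setoid (Σ x : C, x ⟶ x) where
  r p q := ∃ h : p.1 ⟶ q.1, Groupoid.inv h ≫ p.2 ≫ h = q.2
  iseqv :=
    { refl := fun p => ⟨𝟙 _, by simp⟩
      symm := by
        rintro p q ⟨h, e⟩
        exact ⟨Groupoid.inv h, by simp [← e]⟩
      trans := by
        rintro p q r ⟨h, e⟩ ⟨k, e'⟩
        exact ⟨h ≫ k, by simp [← e', ← e]⟩ }

/-- The central elements are the conjugation-invariant functions supported on automorphisms. -/
theorem mem_center_iff {a : GroupoidAlgebra C} :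
    a ∈ Subalgebra.center ℂ (GroupoidAlgebra C) ↔
      (∀ (x y : C) (f : x ⟶ y), x ≠ y → a x y f = 0) ∧
      ∀ (x y : C) (h : x ⟶ y) (g : x ⟶ x), a y y (Groupoid.inv h ≫ g ≫ h) = a x x g := by
  rw [Subalgebra.mem_center_iff]
  constructor
  · intro ha
    constructor
    · intro x y f hxy
      have := congrFun (congrFun (congrFun (ha (single (𝟙 y))) x) y) f
      rw [single_mul_apply, mul_single_apply_of_ne _ _ _ hxy] at this
      simpa using this
    · intro x y h g
      have := congrFun (congrFun (congrFun (ha (single h)) x) y) (g ≫ h)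
      rw [single_mul_apply, mul_single_apply] at this
      simpa using this.symm
  · rintro ⟨h0, h1⟩ b
    refine LinearMap.congr_fun ((basis C).ext (f₁ := LinearMap.mulRight ℂ a)
      (f₂ := LinearMap.mulLeft ℂ a) ?_) b
    rintro ⟨u, v, h⟩
    rw [basis_apply, LinearMap.mulRight_apply, LinearMap.mulLeft_apply]
    ext x y k
    by_cases hy : y = v
    · subst hy
      rw [single_mul_apply]
      by_cases hx : x = u
      · subst hx
        rw [mul_single_apply, ← h1 x y h]
        simp
      · rw [mul_single_apply_of_ne _ _ _ hx, h0 _ _ _ hx]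
    · rw [single_mul_apply_of_ne _ _ _ hy]
      by_cases hx : x = u
      · subst hx
        rw [mul_single_apply, h0 _ _ _ (Ne.symm hy)]
      · rw [mul_single_apply_of_ne _ _ _ hx]

open Classical in
/-- The element of `ℂ[𝒢]` whose coefficients on automorphisms are given by a function of the
conjugacy class, and whose coefficients on all other morphisms vanish. -/
noncomputable def ofClassFunction (φ : Quotient (autSetoid C) → ℂ) : GroupoidAlgebra C :=
  fun x y f => if h : y = x then φ (Quotient.mk _ ⟨x, f ≫ eqToHom h⟩) else 0

omit [Finite C] [∀ x y : C, Finite (x ⟶ y)] in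
theorem ofClassFunction_apply_self (φ : Quotient (autSetoid C) → ℂ) {x : C} (f : x ⟶ x) :
    ofClassFunction φ x x f = φ (Quotient.mk _ ⟨x, f⟩) := by
  refine (dif_pos rfl).trans ?_
  simp

omit [Finite C] [∀ x y : C, Finite (x ⟶ y)] in
theorem ofClassFunction_apply_of_ne (φ : Quotient (autSetoid C) → ℂ) {x y : C} (f : x ⟶ y)
    (h : x ≠ y) : ofClassFunction φ x y f = 0 :=
  dif_neg h.symm

theorem finrank_center :
    Module.finrank ℂ (Subalgebra.center ℂ (GroupoidAlgebra C)) =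
      Nat.card (Quotient (autSetoid C)) := by
  rw [Nat.card_eq_fintype_card, ← Module.finrank_fintype_fun_eq_card ℂ]
  symm
  let F : (Quotient (autSetoid C) → ℂ) →ₗ[ℂ] GroupoidAlgebra C :=
    { toFun := ofClassFunction
      map_add' := fun φ ψ => by
        ext x y f
        rw [add_apply]
        by_cases h : x = y
        · subst h
          simp only [ofClassFunction_apply_self, Pi.add_apply]
        · simp only [ofClassFunction_apply_of_ne _ _ h, add_zero]
      map_smul' := fun c φ => by
        ext x y f
        rw [RingHom.id_apply, smul_apply]
        by_cases h : x = y
        · subst h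
          simp only [ofClassFunction_apply_self, Pi.smul_apply, smul_eq_mul]
        · simp only [ofClassFunction_apply_of_ne _ _ h, mul_zero] }
  have hinj : Function.Injective F := by
    intro φ ψ h
    funext q
    induction q using Quotient.inductionOn with
    | h p =>
      have := congrFun (congrFun (congrFun h p.1) p.1) p.2
      exact (ofClassFunction_apply_self φ p.2).symm.trans
        (this.trans (ofClassFunction_apply_self ψ p.2))
  have hr : LinearMap.range F =
      Subalgebra.toSubmodule (Subalgebra.center ℂ (GroupoidAlgebra C)) := by
    ext a
    rw [Subalgebra.mem_toSubmodule, mem_center_iff, LinearMap.mem_range]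
    constructor
    · rintro ⟨φ, rfl⟩
      refine ⟨fun x y f => ofClassFunction_apply_of_ne φ f, fun x y h g => ?_⟩
      refine (ofClassFunction_apply_self φ _).trans (Eq.trans ?_
        (ofClassFunction_apply_self φ g).symm)
      have e : (autSetoid C).r ⟨x, g⟩ ⟨y, Groupoid.inv h ≫ g ≫ h⟩ := ⟨h, rfl⟩
      exact congrArg φ (Quotient.sound e).symm
    · rintro ⟨h0, h1⟩
      refine ⟨Quotient.lift (fun p => a p.1 p.1 p.2) ?_, ?_⟩
      · rintro ⟨x, g⟩ ⟨y, k⟩ ⟨h, e⟩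
        dsimp only at h e ⊢
        rw [← e, h1]
      · ext x y f
        by_cases h : x = y
        · subst h
          exact ofClassFunction_apply_self _ f
        · exact (ofClassFunction_apply_of_ne _ f h).trans (h0 _ _ _ h).symm
  exact ((LinearEquiv.ofInjective F hinj).trans (LinearEquiv.ofEq _ _ hr)).finrank_eq

/-- The simple modules of the algebra of a finite groupoid are counted by the conjugacy classes of
its automorphisms. -/
theorem card_irr : Nat.card (Irr (GroupoidAlgebra C)) = Nat.card (Quotient (autSetoid C)) := by
  rw [Irr.card_eq_finrank_center ℂ, finrank_center]

end GroupoidAlgebra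

/-! ### Commuting tuples -/

namespace CommTuple

variable {n : ℕ} {G : Type*} [Group G]

instance [Finite G] : Finite (CommTuple n G) :=
  inferInstanceAs (Finite {x : Fin n → G // ∀ i j, Commute (x i) (x j)})

@[ext]
theorem ext {x y : CommTuple n G} (h : ∀ i, x.1 i = y.1 i) : x = y :=
  Subtype.ext (funext h)

theorem smul_val_apply (a : ConjAct G) (x : CommTuple n G) (i : Fin n) :
    (a • x).1 i = ConjAct.ofConjAct a * x.1 i * (ConjAct.ofConjAct a)⁻¹ := rfl

/-- Prepending to a commuting tuple an element of its joint centralizer. -/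
def cons (x : CommTuple n G) (g : G) (hg : g ∈ x.jointCentralizer) : CommTuple (n + 1) G :=
  ⟨Fin.cons g x.1, fun i j => by
    rw [mem_jointCentralizer] at hg
    induction i using Fin.cases with
    | zero =>
      induction j using Fin.cases with
      | zero => exact Commute.refl _
      | succ j => exact hg j
    | succ i =>
      induction j using Fin.cases with
      | zero => exact (hg i).symm
      | succ j => exact x.2 i j⟩

theorem cons_inj {x y : CommTuple n G} {g h : G} {hg : g ∈ x.jointCentralizer}
    {hh : h ∈ y.jointCentralizer} : x.cons g hg = y.cons h hh ↔ x = y ∧ g = h := by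
  simp only [CommTuple.ext_iff, Fin.forall_fin_succ]
  exact and_comm

theorem exists_eq_cons (z : CommTuple (n + 1) G) : ∃ x g hg, z = cons x g hg :=
  ⟨⟨fun i => z.1 i.succ, fun _ _ => z.2 _ _⟩, z.1 0, mem_jointCentralizer.2 fun i => z.2 0 i.succ,
    Subtype.ext (Fin.cons_self_tail z.1).symm⟩

theorem mem_jointCentralizer_cons {x : CommTuple n G} {g : G} {hg : g ∈ x.jointCentralizer}
    {t : G} : t ∈ (x.cons g hg).jointCentralizer ↔ t ∈ x.jointCentralizer ∧ Commute t g := by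
  rw [mem_jointCentralizer, mem_jointCentralizer, Fin.forall_fin_succ, and_comm]
  rfl

theorem mem_stabilizer_iff {x : CommTuple n G} {a : ConjAct G} :
    a ∈ MulAction.stabilizer (ConjAct G) x ↔ ConjAct.ofConjAct a ∈ x.jointCentralizer := by
  rw [MulAction.mem_stabilizer_iff, mem_jointCentralizer, CommTuple.ext_iff]
  exact forall_congr' fun i => mul_inv_eq_iff_eq_mul

theorem mem_jointCentralizer_smul {x : CommTuple n G} {a : ConjAct G} {t : G} :
    ConjAct.ofConjAct a * t * (ConjAct.ofConjAct a)⁻¹ ∈ (a • x).jointCentralizer ↔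
      t ∈ x.jointCentralizer := by
  simp only [mem_jointCentralizer, smul_val_apply]
  refine forall_congr' fun i => ?_
  simp only [mul_assoc, inv_mul_cancel_left, mul_right_inj]
  simp only [← mul_assoc, mul_left_inj]

theorem smul_cons (a : ConjAct G) (x : CommTuple n G) (g : G) (hg : g ∈ x.jointCentralizer) :
    a • x.cons g hg = (a • x).cons (ConjAct.ofConjAct a * g * (ConjAct.ofConjAct a)⁻¹)
      (mem_jointCentralizer_smul.2 hg) :=
  Subtype.ext (funext fun i => Fin.cases rfl (fun _ => rfl) i)

theorem card_stabilizer (x : CommTuple n G) :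
    Nat.card (MulAction.stabilizer (ConjAct G) x) = Nat.card x.jointCentralizer :=
  Nat.card_congr (ConjAct.ofConjAct.toEquiv.subtypeEquiv fun _ => mem_stabilizer_iff)

/-- A commuting `(n+1)`-tuple is a commuting `n`-tuple and an element of its joint centralizer. -/
noncomputable def consEquiv : (Σ x : CommTuple n G, x.jointCentralizer) ≃ CommTuple (n + 1) G :=
  Equiv.ofBijective (fun p => p.1.cons p.2.1 p.2.2) ⟨by
    rintro ⟨x, g, hg⟩ ⟨y, h, hh⟩ e
    obtain ⟨rfl, rfl⟩ := cons_inj.1 e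
    rfl, fun z => by
    obtain ⟨x, g, hg, rfl⟩ := exists_eq_cons z
    exact ⟨⟨x, g, hg⟩, rfl⟩⟩

/-- A commuting `(n+2)`-tuple is a commuting `n`-tuple and a commuting pair of elements of its
joint centralizer. -/
noncomputable def consConsEquiv : (Σ x : CommTuple n G,
    {p : x.jointCentralizer × x.jointCentralizer // Commute p.1 p.2}) ≃ CommTuple (n + 2) G :=
  Equiv.ofBijective (fun p => (p.1.cons p.2.1.1.1 p.2.1.1.2).cons p.2.1.2.1
    (mem_jointCentralizer_cons.2 ⟨p.2.1.2.2, congrArg Subtype.val p.2.2.symm⟩)) ⟨by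
    rintro ⟨x, ⟨⟨g, hg⟩, g', hg'⟩, _⟩ ⟨y, ⟨⟨h, hh⟩, h', hh'⟩, _⟩ e
    obtain ⟨e, rfl⟩ := cons_inj.1 e
    obtain ⟨rfl, rfl⟩ := cons_inj.1 e
    rfl, fun z => by
    obtain ⟨y, h, hh, rfl⟩ := exists_eq_cons z
    obtain ⟨x, g, hg, rfl⟩ := exists_eq_cons y
    have hh' := mem_jointCentralizer_cons.1 hh
    exact ⟨⟨x, ⟨⟨g, hg⟩, h, hh'.1⟩, Subtype.ext hh'.2.symm⟩, rfl⟩⟩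

end CommTuple

/-- Burnside's lemma with a weight `f` on the orbits; the usual form is `f = 1`. -/
theorem MulAction.sum_card_stabilizer_mul {G X : Type*} [Group G] [Finite G] [Fintype X]
    [MulAction G X] [Fintype (orbitRel.Quotient G X)] (f : orbitRel.Quotient G X → ℕ) :
    ∑ x : X, Nat.card (stabilizer G x) * f (Quotient.mk _ x) = Nat.card G * ∑ o, f o := by
  classical
  have := Fintype.ofFinite G
  rw [Fintype.sum_equiv (selfEquivSigmaOrbits G X) _
    (fun p => Nat.card (stabilizer G p.1.out) * f p.1), Fintype.sum_sigma, Finset.mul_sum]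
  · refine Finset.sum_congr rfl fun o _ => ?_
    dsimp only
    rw [Finset.sum_const, Finset.card_univ, smul_eq_mul, ← mul_assoc, Fintype.card_eq_nat_card,
      ← Nat.card_prod, Nat.card_congr (orbitProdStabilizerEquivGroup G o.out)]
  · intro x
    have hx : (selfEquivSigmaOrbits G X x).1 = Quotient.mk _ x := rfl
    rw [hx]
    congr 1
    have : x ∈ orbit G (Quotient.mk (orbitRel G X) x).out :=
      (orbitRel G X).symm (Quotient.mk_out x)
    exact Nat.card_congr (stabilizerEquivStabilizerOfOrbitRel this).toEquiv

namespace CommTuple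

variable {n : ℕ} {G : Type*} [Group G] [Finite G]

attribute [local instance] Fintype.ofFinite

variable (n G)

/-- Burnside's lemma for the conjugation action on commuting `n`-tuples. -/
theorem card_succ : Nat.card (CommTuple (n + 1) G) =
    Nat.card G * Nat.card (MulAction.orbitRel.Quotient (ConjAct G) (CommTuple n G)) := by
  have := MulAction.sum_card_stabilizer_mul (G := ConjAct G) (X := CommTuple n G) (fun _ => 1)
  simp only [mul_one, Finset.sum_const, Finset.card_univ, smul_eq_mul, card_stabilizer] at this
  rw [Fintype.card_eq_nat_card] at this
  rw [← Nat.card_congr consEquiv, Nat.card_sigma]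
  exact this

/-- Burnside's lemma weighted by `k(C_G(x))`, since `C_G(x)` has `|C_G(x)| · k(C_G(x))` commuting
pairs. -/
theorem card_add_two : Nat.card (CommTuple (n + 2) G) = Nat.card G *
    ∑ᶠ o : MulAction.orbitRel.Quotient (ConjAct G) (CommTuple n G), centralizerClassNumber o := by
  rw [finsum_eq_sum_of_fintype]
  have := MulAction.sum_card_stabilizer_mul (G := ConjAct G) (X := CommTuple n G)
    centralizerClassNumber
  refine Eq.trans ?_ this
  rw [← Nat.card_congr consConsEquiv, Nat.card_sigma]
  refine Finset.sum_congr rfl fun x _ => ?_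
  rw [card_comm_eq_card_conjClasses_mul_card, card_stabilizer, mul_comm]
  rfl

theorem finsum_centralizerClassNumber :
    ∑ᶠ o : MulAction.orbitRel.Quotient (ConjAct G) (CommTuple n G), centralizerClassNumber o =
      Nat.card (MulAction.orbitRel.Quotient (ConjAct G) (CommTuple (n + 1) G)) :=
  Nat.eq_of_mul_eq_mul_left (Nat.card_pos (α := G))
    ((card_add_two n G).symm.trans (card_succ (n + 1) G))

end CommTuple

/-! ### Homomorphisms from `ℤⁿ` -/

namespace FreeAbHom

variable {n : ℕ} {G : Type*} [Group G]

/-- The images of the standard generators of `ℤⁿ` under a homomorphism to `G`. -/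
def toCommTuple (φ : FreeAbHom n G) : CommTuple n G :=
  ⟨fun i => DFunLike.coe (F := FreeAb n →* G) φ (Multiplicative.ofAdd (Pi.single i 1)),
    fun _ _ => (Commute.all _ _).map (show FreeAb n →* G from φ)⟩

theorem toCommTuple_injective : Function.Injective (toCommTuple (n := n) (G := G)) := by
  intro φ ψ h
  have hφ (i : Fin n) := congrFun (congrArg Subtype.val h) i
  refine MonoidHom.toAdditiveRight.injective (a₁ := (φ : FreeAb n →* G)) ?_
  refine AddMonoidHom.pi_ext fun i k => ?_
  have hk : Pi.single (M := fun _ : Fin n => ℤ) i k = k • Pi.single i 1 := by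
    rw [← Pi.single_smul]
    simp
  rw [hk, map_zsmul, map_zsmul]
  exact congrArg (fun t : Additive G => k • t) (hφ i)

theorem toCommTuple_surjective : Function.Surjective (toCommTuple (n := n) (G := G)) := by
  intro x
  let φ : (∀ _ : Fin n, Multiplicative ℤ) →* G :=
    MonoidHom.noncommPiCoprod (fun i => zpowersHom G (x.1 i)) fun i j _ a b => by
      simp only [zpowersHom_apply]
      exact (x.2 i j).zpow_zpow _ _
  let e : FreeAb n →* (∀ _ : Fin n, Multiplicative ℤ) :=
    { toFun := fun z i => Multiplicative.ofAdd (z.toAdd i)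
      map_one' := rfl
      map_mul' := fun _ _ => rfl }
  refine ⟨(φ.comp e : FreeAb n →* G), Subtype.ext (funext fun i => ?_)⟩
  have he : e (Multiplicative.ofAdd (Pi.single i 1)) =
      Pi.mulSingle i (Multiplicative.ofAdd (1 : ℤ)) := by
    funext j
    by_cases h : j = i
    · subst h
      simp [e]
    · simp [e, h]
  refine (congrArg φ he).trans ?_
  refine (MonoidHom.noncommPiCoprod_mulSingle (N := fun _ => Multiplicative ℤ) _ i
    (Multiplicative.ofAdd (1 : ℤ))).trans ?_
  simp

/-- `Hom(ℤⁿ, G)` is the set of commuting `n`-tuples. -/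
noncomputable def equivCommTuple (n : ℕ) (G : Type*) [Group G] : FreeAbHom n G ≃ CommTuple n G :=
  Equiv.ofBijective toCommTuple ⟨toCommTuple_injective, toCommTuple_surjective⟩

end FreeAbHom

/-- The conjugation actions on `Hom(ℤⁿ, G)` and on `Comm_n(G)` agree definitionally under evaluation
at the generators. -/
theorem higherClassNumber_eq (n : ℕ) (G : Type*) [Group G] :
    higherClassNumber n G =
      Nat.card (MulAction.orbitRel.Quotient (ConjAct G) (CommTuple n G)) :=
  Nat.card_congr (Quotient.congr (FreeAbHom.equivCommTuple n G) fun φ ψ =>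
    exists_congr fun a =>
      ((FreeAbHom.equivCommTuple n G).injective.eq_iff (a := a • ψ) (b := φ)).symm)

theorem card_mul_higherClassNumber (n : ℕ) (G : Type*) [Group G] [Finite G] :
    Nat.card G * higherClassNumber n G = Nat.card (CommTuple (n + 1) G) := by
  rw [higherClassNumber_eq, CommTuple.card_succ]

theorem higherClassNumber_eq_pow_mul (n : ℕ) (G : Type*) [Group G] [Finite G] :
    (higherClassNumber n G : ℚ) = (Nat.card G : ℚ) ^ n * higherCommProb (n + 1) G := by
  have hG : (Nat.card G : ℚ) ≠ 0 := Nat.cast_ne_zero.2 Nat.card_pos.ne'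
  rw [higherCommProb, ← card_mul_higherClassNumber]
  push_cast
  field_simp
  ring

/-! ### The loop groupoid -/

namespace LoopGroupoid

variable {n : ℕ} {G : Type u} [Group G]

/-- Objects of `Λⁿ G` are the commuting `n`-tuples. -/
noncomputable def tupleEquiv (n : ℕ) (G : Type u) [Group G] : LoopGroupoid n G ≃ CommTuple n G :=
  (SingleObj.mapHom (FreeAb n) G).symm.trans (FreeAbHom.equivCommTuple n G)

/-- The element of `G` that is the unique component of a morphism of `Λⁿ G`. Composition in
`SingleObj G` is reversed multiplication. -/
def elt {F F' : LoopGroupoid n G} (α : F ⟶ F') : G :=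
  NatTrans.app (F := F) (G := F') α (SingleObj.star (FreeAb n))

theorem elt_injective {F F' : LoopGroupoid n G} : Function.Injective (elt (F := F) (F' := F')) :=
  fun _ _ h => NatTrans.ext (funext fun _ => h)

theorem elt_comp {F F' F'' : LoopGroupoid n G} (α : F ⟶ F') (β : F' ⟶ F'') :
    elt (α ≫ β) = elt β * elt α := rfl

/-- Naturality says that the component of a morphism conjugates the tuple of the source into that
of the target. -/
theorem exists_elt_eq_iff {F F' : LoopGroupoid n G} {a : G} :
    (∃ α : F ⟶ F', elt α = a) ↔
      tupleEquiv n G F' = ConjAct.toConjAct a • tupleEquiv n G F := by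
  let φ : FreeAbHom n G := (SingleObj.mapHom (FreeAb n) G).symm F
  let φ' : FreeAbHom n G := (SingleObj.mapHom (FreeAb n) G).symm F'
  have h : tupleEquiv n G F' = ConjAct.toConjAct a • tupleEquiv n G F ↔
      φ' = ConjAct.toConjAct a • φ :=
    (FreeAbHom.equivCommTuple n G).injective.eq_iff (a := φ') (b := ConjAct.toConjAct a • φ)
  rw [h]
  constructor
  · rintro ⟨α, rfl⟩
    refine MonoidHom.ext fun z => ?_
    have := NatTrans.naturality (F := F) (G := F') α
      (X := SingleObj.star (FreeAb n)) (Y := SingleObj.star (FreeAb n)) z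
    exact (mul_inv_eq_iff_eq_mul.2 this).symm
  · intro e
    refine ⟨({ app := fun _ => a, naturality := fun _ _ z => ?_ } : NatTrans F F'), rfl⟩
    exact (mul_inv_eq_iff_eq_mul.1 (DFunLike.congr_fun (F := FreeAb n →* G) e z).symm)

theorem tupleEquiv_eq_smul {F F' : LoopGroupoid n G} (α : F ⟶ F') :
    tupleEquiv n G F' = ConjAct.toConjAct (elt α) • tupleEquiv n G F :=
  exists_elt_eq_iff.1 ⟨α, rfl⟩

theorem exists_elt_eq_iff_mem {F : LoopGroupoid n G} {a : G} :
    (∃ α : F ⟶ F, elt α = a) ↔ a ∈ (tupleEquiv n G F).jointCentralizer := by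
  rw [exists_elt_eq_iff, eq_comm, ← MulAction.mem_stabilizer_iff, CommTuple.mem_stabilizer_iff,
    ConjAct.ofConjAct_toConjAct]

/-- The automorphisms in `Λⁿ G` are the commuting `(n+1)`-tuples, the component of the automorphism
coming first. -/
noncomputable def autEquiv (n : ℕ) (G : Type u) [Group G] :
    (Σ F : LoopGroupoid n G, F ⟶ F) ≃ CommTuple (n + 1) G :=
  Equiv.ofBijective (fun p => (tupleEquiv n G p.1).cons (elt p.2)
    (exists_elt_eq_iff_mem.1 ⟨p.2, rfl⟩)) ⟨by
    rintro ⟨F, α⟩ ⟨F', β⟩ e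
    obtain ⟨h, e⟩ := CommTuple.cons_inj.1 e
    obtain rfl := (tupleEquiv n G).injective h
    obtain rfl := elt_injective e
    rfl, fun z => by
    obtain ⟨x, g, hg, rfl⟩ := CommTuple.exists_eq_cons z
    obtain ⟨F, rfl⟩ := (tupleEquiv n G).surjective x
    obtain ⟨α, rfl⟩ := exists_elt_eq_iff_mem.2 hg
    exact ⟨⟨F, α⟩, rfl⟩⟩

theorem autEquiv_apply (p : Σ F : LoopGroupoid n G, F ⟶ F) :
    autEquiv n G p = (tupleEquiv n G p.1).cons (elt p.2) (exists_elt_eq_iff_mem.1 ⟨p.2, rfl⟩) :=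
  rfl

theorem autEquiv_eq_smul_iff {p q : Σ F : LoopGroupoid n G, F ⟶ F} {a : G} :
    autEquiv n G q = ConjAct.toConjAct a • autEquiv n G p ↔
      ∃ h : p.1 ⟶ q.1, elt h = a ∧ Groupoid.inv h ≫ p.2 ≫ h = q.2 := by
  rw [autEquiv_apply, autEquiv_apply, CommTuple.smul_cons, CommTuple.cons_inj, ← exists_elt_eq_iff,
    ConjAct.ofConjAct_toConjAct]
  constructor
  · rintro ⟨⟨h, rfl⟩, e⟩
    exact ⟨h, rfl, elt_injective e.symm⟩
  · rintro ⟨h, rfl, e⟩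
    exact ⟨⟨h, rfl⟩, (congrArg elt e).symm⟩

theorem card_quotient_autSetoid (n : ℕ) (G : Type u) [Group G] :
    Nat.card (Quotient (GroupoidAlgebra.autSetoid (LoopGroupoid n G))) =
      Nat.card (MulAction.orbitRel.Quotient (ConjAct G) (CommTuple (n + 1) G)) := by
  refine Nat.card_congr (Quotient.congr (autEquiv n G) fun p q => ?_)
  refine Iff.trans ?_ ((MulAction.orbitRel (ConjAct G) (CommTuple (n + 1) G)).comm')
  constructor
  · rintro ⟨h, e⟩
    exact ⟨ConjAct.toConjAct (elt h), (autEquiv_eq_smul_iff.2 ⟨h, rfl, e⟩).symm⟩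
  · rintro ⟨a, e⟩
    obtain ⟨h, -, e⟩ := (autEquiv_eq_smul_iff (a := ConjAct.ofConjAct a)).1 e.symm
    exact ⟨h, e⟩

/-- `|Irr ℂ[Λⁿ G]|` is the number of orbits of `G` on the commuting `(n+1)`-tuples. -/
theorem card_irr (n : ℕ) (G : Type u) [Group G] [Finite G] :
    Nat.card (Irr (GroupoidAlgebra (LoopGroupoid n G))) =
      Nat.card (MulAction.orbitRel.Quotient (ConjAct G) (CommTuple (n + 1) G)) := by
  rw [GroupoidAlgebra.card_irr, card_quotient_autSetoid]

end LoopGroupoid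

namespace CommTuple

/-- Every element of `G` is a commuting `1`-tuple. -/
def singletonEquiv (G : Type*) [Group G] : G ≃ CommTuple 1 G where
  toFun g := ⟨fun _ => g, fun _ _ => Commute.refl g⟩
  invFun x := x.1 0
  left_inv _ := rfl
  right_inv x := CommTuple.ext fun i => congrArg x.1 (Subsingleton.elim 0 i)

theorem jointCentralizer_singletonEquiv {G : Type*} [Group G] (g : G) :
    (singletonEquiv G g).jointCentralizer = Subgroup.centralizer {g} := by
  ext t
  rw [mem_jointCentralizer, Subgroup.mem_centralizer_singleton_iff]
  exact Fin.forall_fin_one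

end CommTuple

theorem finsum_elementCentralizerClassNumber (G : Type*) [Group G] :
    ∑ᶠ c : ConjClasses G, elementCentralizerClassNumber c =
      ∑ᶠ o : MulAction.orbitRel.Quotient (ConjAct G) (CommTuple 1 G),
        centralizerClassNumber o := by
  let e : ConjClasses G ≃ MulAction.orbitRel.Quotient (ConjAct G) (CommTuple 1 G) :=
    Quotient.congr (CommTuple.singletonEquiv G) fun g h => by
      refine (isConj_comm.trans isConj_iff).trans ?_
      exact exists_congr fun a =>
        ((CommTuple.singletonEquiv G).injective.eq_iff (a := a * h * a⁻¹) (b := g)).symm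
  refine finsum_eq_of_bijective e e.bijective fun c => ?_
  induction c using Quotient.inductionOn with
  | h g =>
    have h := CommTuple.jointCentralizer_singletonEquiv g
    exact (congrArg (fun H : Subgroup G => classNumber H) h).symm

/-! ### The Drinfeld double -/

namespace DrinfeldDouble

variable {G : Type u} [Group G]

section

variable [Finite G]

/-- The coefficients of an element of `D(G)` in the basis `δ_g ⊗ x`, indexed by the pairs
`(g, x)`. -/
noncomputable def coeffEquiv (G : Type u) [Group G] [Finite G] :
    DrinfeldDouble G ≃ₗ[ℂ] (G × G → ℂ) :=
  (SkewMonoidAlgebra.coeffLinearEquiv (S := ℂ)).trans <|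
    (Finsupp.linearEquivFunOnFinite ℂ (FunctionAlgebra G) G).trans
      { toFun := fun a p => a p.2 p.1
        invFun := fun b x g => b (g, x)
        map_add' := fun _ _ => rfl
        map_smul' := fun _ _ => rfl
        left_inv := fun _ => rfl
        right_inv := fun _ => rfl }

/-- The basis `δ_g ⊗ x` of `D(G)`, indexed by the pairs `(g, x)`. -/
noncomputable def basis (G : Type u) [Group G] [Finite G] :
    Module.Basis (G × G) ℂ (DrinfeldDouble G) :=
  Module.Basis.ofEquivFun (coeffEquiv G)

theorem basis_apply (g x : G) :
    basis G (g, x) = SkewMonoidAlgebra.single x (FunctionAlgebra.delta g) := by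
  classical
  refine (Module.Basis.coe_ofEquivFun (coeffEquiv G) ▸ rfl :
    basis G (g, x) = (coeffEquiv G).symm (Pi.single (g, x) 1)).trans ?_
  rw [LinearEquiv.symm_apply_eq]
  funext ⟨h, y⟩
  change _ = (SkewMonoidAlgebra.single x (FunctionAlgebra.delta g)).coeff y h
  rw [SkewMonoidAlgebra.coeff_single_apply, Pi.single_apply]
  by_cases hy : x = y
  · subst hy
    simp [FunctionAlgebra.delta]
  · rw [if_neg hy, if_neg (fun e => hy (congrArg Prod.snd e).symm)]
    rfl

end

open LoopGroupoid in
/-- The morphisms of `ΛG` are the pairs `(g, x)` where `g` is the target and `x` the conjugating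
element; the source is then `x⁻¹ g x`. -/
noncomputable def morphismEquiv (G : Type u) [Group G] :
    (Σ F F' : LoopGroupoid 1 G, F ⟶ F') ≃ G × G :=
  Equiv.ofBijective (fun m => ((tupleEquiv 1 G m.2.1).1 0, elt m.2.2)) ⟨by
    rintro ⟨F, F', α⟩ ⟨E, E', β⟩ h
    obtain ⟨h1, h2⟩ := Prod.mk.inj h
    dsimp only at h1 h2
    obtain rfl : F' = E' := (tupleEquiv 1 G).injective
      ((CommTuple.singletonEquiv G).symm.injective h1)
    have hs := (tupleEquiv_eq_smul α).symm.trans (tupleEquiv_eq_smul β)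
    rw [h2] at hs
    obtain rfl := (tupleEquiv 1 G).injective (MulAction.injective _ hs)
    obtain rfl := elt_injective h2
    rfl, by
    rintro ⟨g, x⟩
    obtain ⟨F', hF'⟩ := (tupleEquiv 1 G).surjective (CommTuple.singletonEquiv G g)
    obtain ⟨F, hF⟩ := (tupleEquiv 1 G).surjective
      ((ConjAct.toConjAct x)⁻¹ • CommTuple.singletonEquiv G g)
    obtain ⟨α, rfl⟩ := exists_elt_eq_iff.2
      (show tupleEquiv 1 G F' = ConjAct.toConjAct x • tupleEquiv 1 G F by
        rw [hF, smul_inv_smul, hF'])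
    exact ⟨⟨F, F', α⟩, Prod.ext (congrArg (fun z : CommTuple 1 G => z.1 0) hF') rfl⟩⟩

open LoopGroupoid in
theorem morphismEquiv_apply {F F' : LoopGroupoid 1 G} (α : F ⟶ F') :
    morphismEquiv G ⟨F, F', α⟩ = ((tupleEquiv 1 G F').1 0, elt α) := rfl

variable [Finite G]

/-- The isomorphism of vector spaces `ℂ[ΛG] ≃ D(G)` matching the two bases. -/
noncomputable def loopLinearEquiv (G : Type u) [Group G] [Finite G] :
    GroupoidAlgebra (LoopGroupoid 1 G) ≃ₗ[ℂ] DrinfeldDouble G :=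
  (GroupoidAlgebra.basis (LoopGroupoid 1 G)).equiv (basis G) (morphismEquiv G)

open LoopGroupoid in
theorem loopLinearEquiv_single {F F' : LoopGroupoid 1 G} (α : F ⟶ F') :
    loopLinearEquiv G (GroupoidAlgebra.single α) =
      SkewMonoidAlgebra.single (elt α) (FunctionAlgebra.delta ((tupleEquiv 1 G F').1 0)) := by
  rw [← GroupoidAlgebra.basis_apply, loopLinearEquiv, Module.Basis.equiv_apply,
    morphismEquiv_apply, basis_apply]

open LoopGroupoid in
theorem loopLinearEquiv_mul (a b : GroupoidAlgebra (LoopGroupoid 1 G)) :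
    loopLinearEquiv G (a * b) = loopLinearEquiv G a * loopLinearEquiv G b := by
  refine LinearMap.congr_fun₂ (LinearMap.ext_basis (GroupoidAlgebra.basis _)
    (GroupoidAlgebra.basis _)
    (B := (LinearMap.mul ℂ (GroupoidAlgebra (LoopGroupoid 1 G))).compr₂
      (loopLinearEquiv G).toLinearMap)
    (B' := (LinearMap.mul ℂ (DrinfeldDouble G)).compl₁₂
      (loopLinearEquiv G).toLinearMap (loopLinearEquiv G).toLinearMap) ?_) a b
  rintro ⟨Y', Z, α⟩ ⟨X, Y, β⟩
  rw [GroupoidAlgebra.basis_apply, GroupoidAlgebra.basis_apply]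
  change loopLinearEquiv G (GroupoidAlgebra.single α * GroupoidAlgebra.single β) =
    loopLinearEquiv G (GroupoidAlgebra.single α) * loopLinearEquiv G (GroupoidAlgebra.single β)
  rw [loopLinearEquiv_single, loopLinearEquiv_single, basis_mul_basis]
  have hα : (tupleEquiv 1 G Z).1 0 = elt α * (tupleEquiv 1 G Y').1 0 * (elt α)⁻¹ :=
    congrArg (fun z : CommTuple 1 G => z.1 0) (tupleEquiv_eq_smul α)
  by_cases h : Y' = Y
  · subst h
    rw [GroupoidAlgebra.single_mul_single, loopLinearEquiv_single, if_pos hα, elt_comp]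
  · rw [GroupoidAlgebra.single_mul_single_of_ne _ _ h, map_zero, if_neg]
    intro e
    rw [hα] at e
    exact h ((tupleEquiv 1 G).injective ((CommTuple.singletonEquiv G).symm.injective
      (mul_left_cancel (mul_right_cancel e))))

/-- The isomorphism of algebras `ℂ[ΛG] ≃ D(G)`. -/
noncomputable def loopAlgEquiv (G : Type u) [Group G] [Finite G] :
    GroupoidAlgebra (LoopGroupoid 1 G) ≃ₐ[ℂ] DrinfeldDouble G :=
  AlgEquiv.ofLinearEquiv (loopLinearEquiv G) (by
    -- the image of `1` is a left unit for everything in the image of the map, which is surjective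
    have h := loopLinearEquiv_mul (G := G) 1 ((loopLinearEquiv G).symm 1)
    rw [one_mul, LinearEquiv.apply_symm_apply, mul_one] at h
    exact h.symm) loopLinearEquiv_mul

theorem card_irr (G : Type u) [Group G] [Finite G] :
    Nat.card (Irr (DrinfeldDouble G)) =
      Nat.card (Irr (GroupoidAlgebra (LoopGroupoid 1 G))) := by
  have : IsSemisimpleRing (DrinfeldDouble G) := (loopAlgEquiv G).toRingEquiv.isSemisimpleRing
  have : FiniteDimensional ℂ (DrinfeldDouble G) := Module.Finite.of_basis (basis G)
  rw [Irr.card_eq_finrank_center ℂ, Irr.card_eq_finrank_center ℂ,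
    finrank_center_congr ℂ (loopAlgEquiv G)]

end DrinfeldDouble

theorem mainTheorem5 {G : Type u} [Group G] [Finite G] :
    (∀ r : ℕ, 2 ≤ r →
      Nat.card (Irr (GroupoidAlgebra (LoopGroupoid (r - 2) G))) =
        ∑ᶠ o : MulAction.orbitRel.Quotient (ConjAct G) (CommTuple (r - 2) G),
          centralizerClassNumber o ∧
      ∑ᶠ o : MulAction.orbitRel.Quotient (ConjAct G) (CommTuple (r - 2) G),
          centralizerClassNumber o = higherClassNumber (r - 1) G ∧
      (higherClassNumber (r - 1) G : ℚ) = (Nat.card G : ℚ) ^ (r - 1) * higherCommProb r G) ∧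
    (Nat.card (Irr (DrinfeldDouble G)) =
        ∑ᶠ c : ConjClasses G, elementCentralizerClassNumber c ∧
      ((∑ᶠ c : ConjClasses G, elementCentralizerClassNumber c : ℕ) : ℚ) =
        (Nat.card G : ℚ) ^ 2 * higherCommProb 3 G) ∧
    (Nat.card (Irr (GroupoidAlgebra (LoopGroupoid 2 G))) = higherClassNumber 3 G ∧
      (higherClassNumber 3 G : ℚ) = (Nat.card G : ℚ) ^ 3 * higherCommProb 4 G ∧
      higherCommProb 4 G =
        (Nat.card (Irr (GroupoidAlgebra (LoopGroupoid 2 G))) : ℚ) / (Nat.card G : ℚ) ^ 3) := by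
  have hG : (Nat.card G : ℚ) ≠ 0 := Nat.cast_ne_zero.2 Nat.card_pos.ne'
  have hsum (n : ℕ) := CommTuple.finsum_centralizerClassNumber n G
  refine ⟨fun r hr => ?_, ⟨?_, ?_⟩, ?_, higherClassNumber_eq_pow_mul 3 G, ?_⟩
  · obtain ⟨n, rfl⟩ := Nat.exists_eq_add_of_le' hr
    rw [show n + 2 - 2 = n from rfl, show n + 2 - 1 = n + 1 from rfl]
    exact ⟨(LoopGroupoid.card_irr n G).trans (hsum n).symm,
      (hsum n).trans (higherClassNumber_eq (n + 1) G).symm,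
      higherClassNumber_eq_pow_mul (n + 1) G⟩
  · rw [DrinfeldDouble.card_irr, LoopGroupoid.card_irr, finsum_elementCentralizerClassNumber, hsum]
  · rw [finsum_elementCentralizerClassNumber, hsum, ← higherClassNumber_eq,
      higherClassNumber_eq_pow_mul]
  · rw [LoopGroupoid.card_irr, higherClassNumber_eq]
  · rw [LoopGroupoid.card_irr, ← higherClassNumber_eq, higherClassNumber_eq_pow_mul,
      mul_div_cancel_left₀ _ (pow_ne_zero _ hG)]
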